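/- **Setting.** Let $N\ge 2$, let $\Omega\subset\mathbb R^N$ be a smooth bounded open set, $Y=(-\tfrac12,\tfrac12)^N$, $T\subset Y$ a compact set with smooth boundary and nonempty interior, $Y^*=Y\setminus T$, and $\Theta=\bigcup_{k\in\mathbb Z^N}(k+T)$. Let $\partial\Omega=\overline{\Gamma}_1\cup\overline{\Gamma}_2$ with $\Gamma_1,\Gamma_2$ disjoint open parts of $\partial\Omega$ and $\Gamma_1$ of positive surface measure. Let $a_{ijkh}\in L^\infty(\mathbb R^N)$ ($1\le i,j,k,h\le N$) be real and $\mathbb Z^N$-periodic with $a_{ijkh}=a_{jihk}=a_{khij}$ and, for some $\alpha>0$ and almost every $y$, $\sum_{i,j,k,h}a_{ijkh}(y)\zeta_{ij}\zeta_{kh}\ge\alpha|\zeta|^2$ for all $\zeta\in\mathbb R^{N\times N}$. Let $\theta\in L^\infty(\partial\Theta)$ be real, $\mathbb Z^N$-periodic and $\ge\alpha_0>0$ almost everywhere on $\partial\Theta$ for the surface measure, let $\mathbf f\in L^\infty(\mathbb R^N)^N$ be real and $\mathbb Z^N$-periodic, and let $\mathbf t\in L^2(\partial\Omega)^N$ be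 real. Let $\mathbf V$ be the closure in $H^1(\Omega;\mathbb R)^N$ of the restrictions to $\Omega$ of the fields in $C_c^\infty(\mathbb R^N;\mathbb R)^N$ that vanish on $\Gamma_1$. Let $\mathbf V_Y=H^1_\#(Y;\mathbb R)^N$, where $H^1_\#(Y;\mathbb R)$ is the space of real $\mathbb Z^N$-periodic functions in $H^1_{loc}(\mathbb R^N)$ with mean value $0$ on $Y$, normed by the $L^2(Y)$-norm of the gradient. Write $\mathbf e_{ij}(\mathbf v)=\frac12\big(\frac{\partial v^i}{\partial x_j}+\frac{\partial v^j}{\partial x_i}\big)$, let $\mathbf e^y_{ij}$ be the same expression in the variable $y$, and set $\mathbf E_{ij}(\mathbf v)=\mathbf e_{ij}(\mathbf v_0)+\mathbf e^y_{ij}(\mathbf v_1)$ for $\mathbf v=(\mathbf v_0,\mathbf v_1)\in\mathbb F_0^1:=\mathbf V\times L^2(\Omega;\mathbf V_Y)$. Let $\mathbf u=(\mathbf u_0,\mathbf u_1)\in\mathbb F^1_0$ be a solution of the global homogenized problem $$\sum_{i,j,k,h}\iint_{\Omega\times Y^*}a_{ijkh}\,\mathbf E_{ij}(\mathbf u)\mathbf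 E_{kh}(\mathbf v)\,dx\,dy+\iint_{\Omega\times\partial T}\theta\,\mathbf u_0\cdot\mathbf v_0\,dx\,d\sigma=\iint_{\Omega\times Y^*}\mathbf f(y)\cdot\mathbf v_0(x)\,dx\,dy+\int_{\Gamma_2}\mathbf t\cdot\mathbf v_0\,d\Gamma\qquad\text{for all }\mathbf v=(\mathbf v_0,\mathbf v_1)\in\mathbb F^1_0,$$ where in the last integral $\mathbf v_0$ stands for its trace on $\partial\Omega$. For $1\le i,j\le N$ let $\boldsymbol\chi^{ij}\in\mathbf V_Y$ be a solution of the cell problem $$\sum_{p,q,k,h}\int_{Y^*}a_{pqkh}\,\mathbf e^y_{pq}(\boldsymbol\chi^{ij})\,\mathbf e^y_{kh}(\mathbf w)\,dy=\sum_{k,h}\int_{Y^*}a_{ijkh}\,\mathbf e^y_{kh}(\mathbf w)\,dy\qquad\text{for all }\mathbf w\in\mathbf V_Y.$$ **Claim.** There is $\mathbf g\in L^2(\Omega;\mathbf V_Y)$ such that $\mathbf e^y_{ij}(\mathbf g)=0$ a.e. in $\Omega\times Y^*$ for all $1\le i,j\le N$, and $$\mathbf u_1(x,y)=-\sum_{i,j=1}^N\mathbf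 e_{ij}(\mathbf u_0)(x)\,\boldsymbol\chi^{ij}(y)+\mathbf g(x,y)\qquad\text{for almost every }(x,y)\in\Omega\times\mathbb R^N.$$ -/

import Mathlib

open MeasureTheory Filter Topology Set
open scoped ContDiff ENNReal

namespace PerforatedElasticity

noncomputable section

/-- The numerical space `ℝ^N` with its Euclidean structure. -/
abbrev Space (N : ℕ) : Type := EuclideanSpace ℝ (Fin N)

/-! ### Geometry -/

/-- The open unit cell `Y = (-1/2, 1/2)^N`. -/
def cell (N : ℕ) : Set (Space N) := {y | ∀ i, y i ∈ Ioo (-(1 / 2) : ℝ) (1 / 2)}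

/-- The perforated cell `Y* = Y \ T`. -/
def perforatedCell {N : ℕ} (T : Set (Space N)) : Set (Space N) := cell N \ T

/-- The point of `ℝ^N` with integer coordinates `k`. -/
def latticePoint {N : ℕ} (k : Fin N → ℤ) : Space N := WithLp.toLp 2 fun i => (k i : ℝ)

/-- `Θ = ⋃_{k ∈ ℤ^N} (k + T)`. -/
def periodicInclusions {N : ℕ} (T : Set (Space N)) : Set (Space N) :=
  ⋃ k : Fin N → ℤ, (fun y => latticePoint k + y) '' T

/-- `S` has a smooth boundary: near each boundary point there is a smooth function `ρ` with
non-vanishing differential such that the interior of `S` is `{ρ < 0}` and the boundary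
is `{ρ = 0}`. -/
def HasSmoothBoundary {N : ℕ} (S : Set (Space N)) : Prop :=
  ∀ x ∈ frontier S, ∃ (U : Set (Space N)) (ρ : Space N → ℝ), IsOpen U ∧ x ∈ U ∧
    ContDiffOn ℝ ∞ ρ U ∧ (∀ z ∈ U, fderiv ℝ ρ z ≠ 0) ∧
    interior S ∩ U = {z ∈ U | ρ z < 0} ∧ frontier S ∩ U = {z ∈ U | ρ z = 0}

/-- `A` is a (relatively) open part of `B`. -/
def IsOpenPart {N : ℕ} (A B : Set (Space N)) : Prop := ∃ U, IsOpen U ∧ A = U ∩ B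

/-- The surface measure on a hypersurface `S`: the `(N - 1)`-dimensional Hausdorff measure,
normalised so as to agree with Lebesgue measure on hyperplanes, restricted to `S`. -/
def surfaceMeasure {N : ℕ} (S : Set (Space N)) : Measure (Space N) :=
  (Measure.euclideanHausdorffMeasure (N - 1)).restrict S

/-- `f` is `Y`-periodic almost everywhere with respect to `μ`. -/
def IsPeriodicAE {N : ℕ} {F : Type*} (μ : Measure (Space N)) (f : Space N → F) : Prop :=
  ∀ k : Fin N → ℤ, ∀ᵐ y ∂μ, f (y + latticePoint k) = f y

/-! ### Weak derivatives and the strain -/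

/-- `g` is the weak partial derivative `∂f/∂x_j` in the open set `O`. -/
def HasWeakPartial {N : ℕ} (O : Set (Space N)) (j : Fin N) (f g : Space N → ℝ) : Prop :=
  LocallyIntegrableOn f O ∧ LocallyIntegrableOn g O ∧
    ∀ φ : Space N → ℝ, ContDiff ℝ ∞ φ → HasCompactSupport φ → tsupport φ ⊆ O →
      ∫ x in O, f x * fderiv ℝ φ x (EuclideanSpace.single j 1) = -∫ x in O, g x * φ x

open Classical in
/-- The weak partial derivative `∂f/∂x_j` in `O` (a representative of it, which is unique
almost everywhere in `O`; `0` if there is no weak derivative). -/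
def weakPartial {N : ℕ} (O : Set (Space N)) (j : Fin N) (f : Space N → ℝ) : Space N → ℝ :=
  if h : ∃ g, HasWeakPartial O j f g then h.choose else 0

/-- The strain `e_ij(u) = (∂u^i/∂x_j + ∂u^j/∂x_i) / 2` in `O`. -/
def strain {N : ℕ} (O : Set (Space N)) (u : Space N → Space N) (i j : Fin N)
    (x : Space N) : ℝ :=
  (weakPartial O j (fun z => u z i) x + weakPartial O i (fun z => u z j) x) / 2

/-- `u ∈ H¹(O; ℝ)^N`. -/
def MemH1 {N : ℕ} (O : Set (Space N)) (u : Space N → Space N) : Prop :=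
  (∀ i, MemLp (fun x => u x i) 2 (volume.restrict O)) ∧
  (∀ i j, ∃ g, HasWeakPartial O j (fun x => u x i) g) ∧
  ∀ i j, MemLp (weakPartial O j fun x => u x i) 2 (volume.restrict O)

/-- A norm distance of `H¹(O; ℝ)^N` (sum of the `L²` distances of the components and of their
partial derivatives). -/
def h1Dist {N : ℕ} (O : Set (Space N)) (u v : Space N → Space N) : ℝ≥0∞ :=
  ∑ i, eLpNorm (fun x => u x i - v x i) 2 (volume.restrict O) +
    ∑ i, ∑ j, eLpNorm (fun x => weakPartial O j (fun z => u z i) x -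
      weakPartial O j (fun z => v z i) x) 2 (volume.restrict O)

/-- `v` is a vector of functions in `D(ℝ^N; ℝ)`. -/
def IsTestField {N : ℕ} (v : Space N → Space N) : Prop :=
  ContDiff ℝ ∞ v ∧ HasCompactSupport v

/-- The space `V`: the closure in `H¹(Ω; ℝ)^N` of the restrictions to `Ω` of the smooth compactly
supported fields on `ℝ^N` that vanish on `Γ₁`. -/
def MemV {N : ℕ} (Ω Γ₁ : Set (Space N)) (v : Space N → Space N) : Prop :=
  MemH1 Ω v ∧ ∃ φ : ℕ → Space N → Space N,
    (∀ n, IsTestField (φ n) ∧ ∀ x ∈ Γ₁, φ n x = 0) ∧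
    Tendsto (fun n => h1Dist Ω (φ n) v) atTop (𝓝 0)

/-- `γ ∈ L²(∂Ω)^N` is the trace on `∂Ω` of `v ∈ H¹(Ω; ℝ)^N`: there are smooth fields that
converge to `v` in `H¹(Ω)` and whose boundary values converge to `γ` in `L²(∂Ω)`. -/
def IsTrace {N : ℕ} (Ω : Set (Space N)) (v γ : Space N → Space N) : Prop :=
  MemH1 Ω v ∧ MemLp γ 2 (surfaceMeasure (frontier Ω)) ∧
  ∃ φ : ℕ → Space N → Space N, (∀ n, IsTestField (φ n)) ∧
    Tendsto (fun n => h1Dist Ω (φ n) v) atTop (𝓝 0) ∧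
    Tendsto (fun n => eLpNorm (φ n - γ) 2 (surfaceMeasure (frontier Ω))) atTop (𝓝 0)

/-! ### Periodic Sobolev fields -/

/-- `f ∈ L²_loc(ℝ^N)`. -/
def MemL2loc {N : ℕ} (f : Space N → ℝ) : Prop :=
  ∀ K : Set (Space N), IsCompact K → MemLp f 2 (volume.restrict K)

/-- `u ∈ H¹_#(Y; ℝ)`: a `Y`-periodic function in `H¹_loc(ℝ^N)` with mean value zero on `Y`. -/
def MemH1Per {N : ℕ} (u : Space N → ℝ) : Prop :=
  MemL2loc u ∧ (∀ j, ∃ g, HasWeakPartial univ j u g) ∧ (∀ j, MemL2loc (weakPartial univ j u)) ∧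
    IsPeriodicAE volume u ∧ ∫ y in cell N, u y = 0

/-- `w ∈ V_Y = H¹_#(Y; ℝ)^N`. -/
def MemVY {N : ℕ} (w : Space N → Space N) : Prop := ∀ k, MemH1Per fun y => w y k

/-- `g` is a jointly measurable version of the partial derivative `∂f/∂y_j` of a function `f` of
`(x, y) ∈ Ω × ℝ^N`: for almost every `x ∈ Ω`, `g(x, ·)` is the weak derivative of `f(x, ·)`. -/
def HasWeakPartialY {N : ℕ} (Ω : Set (Space N)) (j : Fin N) (f g : Space N × Space N → ℝ) :
    Prop :=
  AEStronglyMeasurable g (volume.restrict (Ω ×ˢ univ)) ∧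
  ∀ᵐ x ∂volume.restrict Ω, HasWeakPartial univ j (fun y => f (x, y)) fun y => g (x, y)

open Classical in
/-- The partial derivative `∂f/∂y_j` on `Ω × ℝ^N` (a representative of it, which is unique almost
everywhere in `Ω × ℝ^N`; `0` if there is none). -/
def weakPartialY {N : ℕ} (Ω : Set (Space N)) (j : Fin N) (f : Space N × Space N → ℝ) :
    Space N × Space N → ℝ :=
  if h : ∃ g, HasWeakPartialY Ω j f g then h.choose else 0

/-- The strain in the variable `y`: `e^y_ij(v) = (∂v^i/∂y_j + ∂v^j/∂y_i) / 2`. -/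
def strainY {N : ℕ} (Ω : Set (Space N)) (v : Space N × Space N → Space N) (i j : Fin N)
    (p : Space N × Space N) : ℝ :=
  (weakPartialY Ω j (fun q => v q i) p + weakPartialY Ω i (fun q => v q j) p) / 2

/-- `v ∈ L²(Ω; V_Y)`, as a jointly measurable function of `(x, y) ∈ Ω × ℝ^N`: `v(x, ·) ∈ V_Y` for
almost every `x ∈ Ω`, and the gradient norm of `v(x, ·)` in `V_Y` is square integrable over `Ω`,
that is, `∂v/∂y_j ∈ L²(Ω × Y)`. -/
def MemL2VY {N : ℕ} (Ω : Set (Space N)) (v : Space N × Space N → Space N) : Prop :=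
  AEStronglyMeasurable v (volume.restrict (Ω ×ˢ univ)) ∧
  (∀ᵐ x ∂volume.restrict Ω, MemVY fun y => v (x, y)) ∧
  (∀ i j, ∃ g, HasWeakPartialY Ω j (fun p => v p i) g) ∧
  ∀ i j, MemLp (weakPartialY Ω j fun p => v p i) 2 (volume.restrict (Ω ×ˢ cell N))

/-! ### The variational problems -/

/-- `E_ij(v) = e_ij(v₀) + e^y_ij(v₁)` for `v = (v₀, v₁)`. -/
def twoScaleStrain {N : ℕ} (Ω : Set (Space N)) (v₀ : Space N → Space N)
    (v₁ : Space N × Space N → Space N) (i j : Fin N) (p : Space N × Space N) : ℝ :=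
  strain Ω v₀ i j p.1 + strainY Ω v₁ i j p

/-- The bilinear form `â_Ω((u₀, u₁), (v₀, v₁))`, with `∫∫ a_ijkh E_ij(u) E_kh(v) dx dy` over
`Ω × Y*` and `∫∫ θ u₀ · v₀ dx dσ` over `Ω × ∂T`. -/
def globalForm {N : ℕ} (Ω T : Set (Space N)) (a : Fin N → Fin N → Fin N → Fin N → Space N → ℝ)
    (θ : Space N → ℝ) (u₀ : Space N → Space N) (u₁ : Space N × Space N → Space N)
    (v₀ : Space N → Space N) (v₁ : Space N × Space N → Space N) : ℝ :=
  (∑ i, ∑ j, ∑ k, ∑ h, ∫ p in Ω ×ˢ perforatedCell T,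
      a i j k h p.2 * twoScaleStrain Ω u₀ u₁ i j p * twoScaleStrain Ω v₀ v₁ k h p) +
    ∫ p, θ p.2 * inner ℝ (u₀ p.1) (v₀ p.1)
      ∂((volume.restrict Ω).prod (surfaceMeasure (frontier T)))

/-- The linear form `l̂_Ω(v) = ∫∫_{Ω × Y*} f · v₀ dx dy + ∫_{Γ₂} t · v₀ dΓ`, where `γ` is the trace
of `v₀`. -/
def globalLoad {N : ℕ} (Ω T Γ₂ : Set (Space N)) (f t : Space N → Space N)
    (v₀ γ : Space N → Space N) : ℝ :=
  (∫ p in Ω ×ˢ perforatedCell T, inner ℝ (f p.2) (v₀ p.1)) +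
    ∫ x, inner ℝ (t x) (γ x) ∂surfaceMeasure Γ₂

/-- `(u₀, u₁) ∈ V × L²(Ω; V_Y)` solves the global homogenized variational problem
`â_Ω(u, v) = l̂_Ω(v)` for all `v = (v₀, v₁) ∈ V × L²(Ω; V_Y)`. -/
def IsGlobalSolution {N : ℕ} (Ω T Γ₁ Γ₂ : Set (Space N))
    (a : Fin N → Fin N → Fin N → Fin N → Space N → ℝ) (θ : Space N → ℝ)
    (f t : Space N → Space N) (u₀ : Space N → Space N)
    (u₁ : Space N × Space N → Space N) : Prop :=
  MemV Ω Γ₁ u₀ ∧ MemL2VY Ω u₁ ∧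
  ∀ (v₀ γ : Space N → Space N) (v₁ : Space N × Space N → Space N),
    MemV Ω Γ₁ v₀ → IsTrace Ω v₀ γ → MemL2VY Ω v₁ →
      globalForm Ω T a θ u₀ u₁ v₀ v₁ = globalLoad Ω T Γ₂ f t v₀ γ

/-- The bilinear form `â(v, w) = ∑ ∫_{Y*} a_ijkh e^y_ij(v) e^y_kh(w) dy` of the perforated cell. -/
def cellForm {N : ℕ} (T : Set (Space N)) (a : Fin N → Fin N → Fin N → Fin N → Space N → ℝ)
    (v w : Space N → Space N) : ℝ :=
  ∑ i, ∑ j, ∑ k, ∑ h, ∫ y in perforatedCell T,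
    a i j k h y * strain univ v i j y * strain univ w k h y

/-- `χ ∈ V_Y` solves the cell problem of index `(i, j)`:
`â(χ, w) = ∑ ∫_{Y*} a_ijkh e^y_kh(w) dy` for all `w ∈ V_Y`. -/
def IsCellSolution {N : ℕ} (T : Set (Space N))
    (a : Fin N → Fin N → Fin N → Fin N → Space N → ℝ) (i j : Fin N)
    (χ : Space N → Space N) : Prop :=
  MemVY χ ∧ ∀ w : Space N → Space N, MemVY w →
    cellForm T a χ w =
      ∑ k, ∑ h, ∫ y in perforatedCell T, a i j k h y * strain univ w k h y

end

end PerforatedElasticity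

/-! Set `g = u₁ + ∑ e_ij(u₀) χ^ij`, so that the asserted decomposition holds by construction; what
has to be shown is `e^y(g) = 0` on `Ω × Y*`. Testing the global problem with `(0, v₁)` removes the
Robin term and the loads and leaves `∫∫ a (e(u₀) + e^y(u₁)) : e^y(v₁) = 0`
(`IsGlobalSolution.form_strainY_eq_zero`). For almost every `x` the slice `v₁(x, ·)` is admissible
in the cell problem; multiplying by `e_ij(u₀)(x)`, integrating over `Ω` and summing over `i, j`
rewrites the `e(u₀)` part through the `χ^ij` (`IsCellSolution.integral_mul_strainY`). Hence `∫∫ a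
e^y(g) : e^y(v₁) = 0` for every `v₁` (`form_add_sum_eq_zero`). The choice `v₁ = g` and ellipticity
conclude (`strainY_ae_eq_zero_of_form_eq_zero`). Ellipticity sees only the strain on `Y*`, so `g`
itself need not vanish. The remaining work is that `weakPartial` and `weakPartialY` are chosen
representatives: they are linear, and compatible with slicing, only almost everywhere. -/

namespace PerforatedElasticity

/-! ### Weak partial derivatives -/

theorem HasWeakPartial.ae_eq {N : ℕ} {O : Set (Space N)} (hO : IsOpen O) {j : Fin N}
    {f f' g g' : Space N → ℝ} (h : HasWeakPartial O j f g) (h' : HasWeakPartial O j f' g')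
    (hff' : f =ᵐ[volume.restrict O] f') : g =ᵐ[volume.restrict O] g' := by
  -- Fundamental lemma of the calculus of variations, applied to `g - g'`.
  have key : ∀ᵐ x ∂(volume : Measure (Space N)), x ∈ O → (g - g') x = 0 := by
    refine hO.ae_eq_zero_of_integral_contDiff_smul_eq_zero (h.2.1.sub h'.2.1) ?_
    intro φ hφ hc hs
    have hint : ∀ q : Space N → ℝ, LocallyIntegrableOn q O →
        Integrable (fun x => φ x * q x) volume := by
      intro q hq
      have hK : IntegrableOn q (tsupport φ) := hq.integrableOn_compact_subset hs hc
      have : IntegrableOn (fun x => φ x • q x) (tsupport φ) :=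
        hK.continuousOn_smul hφ.continuous.continuousOn hc
      rw [← integrableOn_iff_integrable_of_support_subset (s := tsupport φ)]
      · exact this
      · intro x hx
        exact subset_tsupport _ fun h0 => hx (by simp [h0])
    have hset : ∀ q : Space N → ℝ, ∫ x in O, q x * φ x = ∫ x, φ x * q x := by
      intro q
      rw [setIntegral_eq_integral_of_forall_compl_eq_zero]
      · simp_rw [mul_comm]
      · intro x hx
        rw [image_eq_zero_of_notMem_tsupport fun h0 => hx (hs h0), mul_zero]
    have e1 := h.2.2 φ hφ hc hs
    have e2 := h'.2.2 φ hφ hc hs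
    have e3 : ∫ x in O, f x * fderiv ℝ φ x (EuclideanSpace.single j 1) =
        ∫ x in O, f' x * fderiv ℝ φ x (EuclideanSpace.single j 1) :=
      integral_congr_ae (hff'.mono fun x hx => by simp only [hx])
    rw [hset] at e1 e2
    simp only [Pi.sub_apply, smul_eq_mul, mul_sub]
    rw [integral_sub (hint g h.2.1) (hint g' h'.2.1)]
    linarith
  rw [EventuallyEq, ae_restrict_iff' hO.measurableSet]
  filter_upwards [key] with x hx hxO using sub_eq_zero.1 (hx hxO)

theorem hasWeakPartial_weakPartial {N : ℕ} {O : Set (Space N)} {j : Fin N} {f : Space N → ℝ}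
    (h : ∃ g, HasWeakPartial O j f g) : HasWeakPartial O j f (weakPartial O j f) := by
  rw [weakPartial, dif_pos h]
  exact h.choose_spec

theorem HasWeakPartial.weakPartial_ae_eq {N : ℕ} {O : Set (Space N)} (hO : IsOpen O) {j : Fin N}
    {f g : Space N → ℝ} (h : HasWeakPartial O j f g) :
    weakPartial O j f =ᵐ[volume.restrict O] g :=
  (hasWeakPartial_weakPartial ⟨g, h⟩).ae_eq hO h .rfl

theorem HasWeakPartial.ae_eq_univ {N : ℕ} {j : Fin N} {f g g' : Space N → ℝ}
    (h : HasWeakPartial univ j f g) (h' : HasWeakPartial univ j f g') : g =ᵐ[volume] g' := by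
  have := h.ae_eq isOpen_univ h' .rfl
  rwa [Measure.restrict_univ] at this

theorem HasWeakPartial.weakPartial_ae_eq_univ {N : ℕ} {j : Fin N} {f g : Space N → ℝ}
    (h : HasWeakPartial univ j f g) : weakPartial univ j f =ᵐ[volume] g :=
  (hasWeakPartial_weakPartial ⟨g, h⟩).ae_eq_univ h

theorem hasWeakPartial_zero {N : ℕ} (O : Set (Space N)) (j : Fin N) :
    HasWeakPartial O j (fun _ => 0) (fun _ => 0) :=
  ⟨locallyIntegrable_zero.locallyIntegrableOn _, locallyIntegrable_zero.locallyIntegrableOn _,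
    by simp⟩

theorem HasWeakPartial.add {N : ℕ} {j : Fin N} {f f' g g' : Space N → ℝ}
    (h : HasWeakPartial univ j f g) (h' : HasWeakPartial univ j f' g') :
    HasWeakPartial univ j (fun y => f y + f' y) (fun y => g y + g' y) := by
  refine ⟨h.1.add h'.1, h.2.1.add h'.2.1, fun φ hφ hc hs => ?_⟩
  have e1 := h.2.2 φ hφ hc hs
  have e2 := h'.2.2 φ hφ hc hs
  have hd : Continuous fun x => fderiv ℝ φ x (EuclideanSpace.single j 1) :=
    (hφ.continuous_fderiv (by simp)).clm_apply continuous_const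
  have hdc : HasCompactSupport fun x => fderiv ℝ φ x (EuclideanSpace.single j 1) :=
    hc.fderiv_apply (𝕜 := ℝ) _
  have hint : ∀ {q ψ : Space N → ℝ}, LocallyIntegrableOn q univ → Continuous ψ →
      HasCompactSupport ψ → Integrable (fun x => q x * ψ x) := fun hq hψ hψc =>
    (locallyIntegrableOn_univ.1 hq).integrable_smul_right_of_hasCompactSupport hψ hψc
  simp only [Measure.restrict_univ] at e1 e2 ⊢
  simp only [add_mul]
  rw [integral_add (hint h.1 hd hdc) (hint h'.1 hd hdc),
    integral_add (hint h.2.1 hφ.continuous hc) (hint h'.2.1 hφ.continuous hc), e1, e2]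
  ring

theorem HasWeakPartial.const_mul {N : ℕ} {O : Set (Space N)} {j : Fin N} {f g : Space N → ℝ}
    (h : HasWeakPartial O j f g) (c : ℝ) :
    HasWeakPartial O j (fun y => c * f y) (fun y => c * g y) := by
  refine ⟨h.1.smul c, h.2.1.smul c, fun φ hφ hc hs => ?_⟩
  simp only [mul_assoc, integral_const_mul, h.2.2 φ hφ hc hs, mul_neg]

theorem HasWeakPartial.sum {N : ℕ} {j : Fin N} {ι : Type*} (s : Finset ι)
    {f g : ι → Space N → ℝ} (h : ∀ i, HasWeakPartial univ j (f i) (g i)) :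
    HasWeakPartial univ j (fun y => ∑ i ∈ s, f i y) (fun y => ∑ i ∈ s, g i y) := by
  classical
  induction s using Finset.induction_on with
  | empty => simpa using hasWeakPartial_zero univ j
  | insert i s hi ih => simpa only [Finset.sum_insert hi] using (h i).add ih

/-! ### Derivatives in `y` on `Ω × ℝ^N`, jointly and slice by slice. -/

theorem ae_prod_eq_of_ae_ae_eq {X Z : Type*} [MeasurableSpace X] [MeasurableSpace Z]
    {μ : Measure X} {ν : Measure Z} [SFinite ν] {f g : X × Z → ℝ}
    (hf : AEStronglyMeasurable f (μ.prod ν)) (hg : AEStronglyMeasurable g (μ.prod ν))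
    (h : ∀ᵐ x ∂μ, ∀ᵐ y ∂ν, f (x, y) = g (x, y)) : f =ᵐ[μ.prod ν] g := by
  -- Fubini for null sets needs a measurable equality set, which only the measurable representatives
  -- provide.
  have key : hf.mk f =ᵐ[μ.prod ν] hg.mk g := by
    have hm : MeasurableSet {p | hf.mk f p = hg.mk g p} :=
      measurableSet_eq_fun hf.stronglyMeasurable_mk.measurable hg.stronglyMeasurable_mk.measurable
    refine (Measure.ae_prod_iff_ae_ae hm).2 ?_
    filter_upwards [h, Measure.ae_ae_of_ae_prod hf.ae_eq_mk, Measure.ae_ae_of_ae_prod hg.ae_eq_mk]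
      with x h1 h2 h3
    filter_upwards [h1, h2, h3] with y h1 h2 h3
    rw [← h2, ← h3, h1]
  exact hf.ae_eq_mk.trans (key.trans hg.ae_eq_mk.symm)

theorem volume_restrict_prod_univ {N : ℕ} (Ω : Set (Space N)) :
    (volume : Measure (Space N × Space N)).restrict (Ω ×ˢ univ) =
      (volume.restrict Ω).prod volume := by
  rw [Measure.volume_eq_prod, ← Measure.prod_restrict, Measure.restrict_univ]

theorem volume_restrict_prod {N : ℕ} (Ω S : Set (Space N)) :
    (volume : Measure (Space N × Space N)).restrict (Ω ×ˢ S) =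
      (volume.restrict Ω).prod (volume.restrict S) := by
  rw [Measure.volume_eq_prod, ← Measure.prod_restrict]

theorem hasWeakPartialY_weakPartialY {N : ℕ} {Ω : Set (Space N)} {j : Fin N}
    {f : Space N × Space N → ℝ} (h : ∃ g, HasWeakPartialY Ω j f g) :
    HasWeakPartialY Ω j f (weakPartialY Ω j f) := by
  rw [weakPartialY, dif_pos h]
  exact h.choose_spec

/-- Uniqueness holds on almost every slice; the joint measurability in `HasWeakPartialY` upgrades it
to the product. -/
theorem HasWeakPartialY.weakPartialY_ae_eq {N : ℕ} {Ω : Set (Space N)} {j : Fin N}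
    {f g : Space N × Space N → ℝ} (h : HasWeakPartialY Ω j f g) :
    weakPartialY Ω j f =ᵐ[volume.restrict (Ω ×ˢ univ)] g := by
  have h' := hasWeakPartialY_weakPartialY ⟨g, h⟩
  have m := h.1
  have m' := h'.1
  rw [volume_restrict_prod_univ] at m m' ⊢
  refine ae_prod_eq_of_ae_ae_eq m' m ?_
  filter_upwards [h.2, h'.2] with x hx hx'
  exact hx'.ae_eq_univ hx

/-- Reconciles two independent choices: a derivative chosen separately on each slice, and one chosen
jointly. -/
theorem HasWeakPartialY.ae_weakPartial_eq {N : ℕ} {Ω : Set (Space N)} {j : Fin N}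
    {f g : Space N × Space N → ℝ} (h : HasWeakPartialY Ω j f g) :
    ∀ᵐ x ∂volume.restrict Ω,
      ∀ᵐ y, weakPartial univ j (fun z => f (x, z)) y = weakPartialY Ω j f (x, y) := by
  filter_upwards [(hasWeakPartialY_weakPartialY ⟨g, h⟩).2] with x hx
  exact hx.weakPartial_ae_eq_univ

/-! ### Periodic fields -/

theorem isBounded_cell (N : ℕ) : Bornology.IsBounded (cell N) := by
  refine (Metric.isBounded_closedBall (x := (0 : Space N)) (r := √(∑ _i : Fin N, 1))).subset ?_
  intro y hy
  rw [mem_closedBall_zero_iff, EuclideanSpace.norm_eq]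
  refine Real.sqrt_le_sqrt (Finset.sum_le_sum fun i _ => ?_)
  have := hy i
  rw [Real.norm_eq_abs, sq_abs]
  nlinarith [this.1, this.2]

instance isFiniteMeasure_cell (N : ℕ) : IsFiniteMeasure (volume.restrict (cell N)) :=
  isFiniteMeasure_restrict.2 (isBounded_cell N).measure_lt_top.ne

theorem MemL2loc.memLp_cell {N : ℕ} {f : Space N → ℝ} (h : MemL2loc f) :
    MemLp f 2 (volume.restrict (cell N)) :=
  (h _ (isBounded_cell N).isCompact_closure).mono_measure
    (Measure.restrict_mono_set _ subset_closure)

theorem MemH1Per.add {N : ℕ} {u v : Space N → ℝ} (hu : MemH1Per u) (hv : MemH1Per v) :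
    MemH1Per fun y => u y + v y := by
  obtain ⟨u1, u2, u3, u4, u5⟩ := hu
  obtain ⟨v1, v2, v3, v4, v5⟩ := hv
  have hw j := (hasWeakPartial_weakPartial (u2 j)).add (hasWeakPartial_weakPartial (v2 j))
  refine ⟨fun K hK => (u1 K hK).add (v1 K hK), fun j => ⟨_, hw j⟩, fun j K hK => ?_,
    fun k => ?_, ?_⟩
  -- The chosen derivative of the sum agrees only a.e. with the sum of the chosen derivatives.
  · refine ((u3 j K hK).add (v3 j K hK)).ae_eq (ae_restrict_of_ae ?_)
    exact (hw j).weakPartial_ae_eq_univ.symm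
  · filter_upwards [u4 k, v4 k] with y h1 h2
    rw [h1, h2]
  · rw [integral_add (u1.memLp_cell.integrable one_le_two) (v1.memLp_cell.integrable one_le_two),
      u5, v5, add_zero]

theorem MemH1Per.const_mul {N : ℕ} {u : Space N → ℝ} (hu : MemH1Per u) (c : ℝ) :
    MemH1Per fun y => c * u y := by
  obtain ⟨u1, u2, u3, u4, u5⟩ := hu
  have hw j := (hasWeakPartial_weakPartial (u2 j)).const_mul c
  refine ⟨fun K hK => (u1 K hK).const_mul c, fun j => ⟨_, hw j⟩, fun j K hK => ?_,
    fun k => ?_, ?_⟩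
  · refine ((u3 j K hK).const_mul c).ae_eq (ae_restrict_of_ae ?_)
    exact (hw j).weakPartial_ae_eq_univ.symm
  · filter_upwards [u4 k] with y h1
    rw [h1]
  · rw [integral_const_mul, u5, mul_zero]

theorem memH1Per_zero {N : ℕ} : MemH1Per fun _ : Space N => (0 : ℝ) := by
  refine ⟨fun K _ => MemLp.zero, fun j => ⟨_, hasWeakPartial_zero univ j⟩, fun j K _ => ?_,
    fun k => by simp, by simp⟩
  refine MemLp.zero.ae_eq (ae_restrict_of_ae ?_)
  exact (hasWeakPartial_zero univ j).weakPartial_ae_eq_univ.symm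

theorem MemVY.add {N : ℕ} {v w : Space N → Space N} (hv : MemVY v) (hw : MemVY w) :
    MemVY fun y => v y + w y :=
  fun k => (hv k).add (hw k)

theorem MemVY.const_smul {N : ℕ} {v : Space N → Space N} (hv : MemVY v) (c : ℝ) :
    MemVY fun y => c • v y :=
  fun k => (hv k).const_mul c

theorem MemVY.sum {N : ℕ} {ι : Type*} (s : Finset ι) {v : ι → Space N → Space N}
    (hv : ∀ i, MemVY (v i)) : MemVY fun y => ∑ i ∈ s, v i y := by
  classical
  induction s using Finset.induction_on with
  | empty => exact fun k => by simpa using memH1Per_zero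
  | insert i s hi ih => simpa only [Finset.sum_insert hi] using (hv i).add ih

theorem aestronglyMeasurable_of_apply {X : Type*} [MeasurableSpace X] {μ : Measure X} {N : ℕ}
    {v : X → Space N} (h : ∀ i, AEStronglyMeasurable (fun x => v x i) μ) :
    AEStronglyMeasurable v μ := by
  have : AEMeasurable (fun x => WithLp.ofLp (v x)) μ :=
    aemeasurable_pi_lambda _ fun i => (h i).aemeasurable
  exact ((PiLp.continuous_toLp 2 _).measurable.comp_aemeasurable this).aestronglyMeasurable

theorem MemVY.aestronglyMeasurable {N : ℕ} {v : Space N → Space N} (hv : MemVY v) :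
    AEStronglyMeasurable v volume :=
  aestronglyMeasurable_of_apply fun k => by
    -- Any direction would do, since only the local integrability of the component is used; `k` is
    -- an index at hand.
    obtain ⟨g, hg⟩ := (hv k).2.1 k
    exact (locallyIntegrableOn_univ.1 hg.1).aestronglyMeasurable

theorem memLp_fst_mul_snd {X Z : Type*} [MeasurableSpace X] [MeasurableSpace Z]
    {μ : Measure X} {ν : Measure Z} [SFinite μ] [SFinite ν] {f : X → ℝ} {g : Z → ℝ}
    (hf : MemLp f 2 μ) (hg : MemLp g 2 ν) : MemLp (fun p : X × Z => f p.1 * g p.2) 2 (μ.prod ν) := by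
  refine (memLp_two_iff_integrable_sq (hf.1.comp_fst.mul hg.1.comp_snd)).2 ?_
  simpa only [Pi.mul_apply, mul_pow] using hf.integrable_sq.mul_prod hg.integrable_sq

theorem ae_snd_prod_restrict {N : ℕ} {X : Type*} [MeasurableSpace X] (μ : Measure X)
    (S : Set (Space N)) {P : Space N → Prop} (h : ∀ᵐ y, P y) :
    ∀ᵐ p ∂μ.prod (volume.restrict S), P p.2 :=
  Measure.quasiMeasurePreserving_snd.ae (ae_restrict_of_ae h)

/-! ### Adding a separated sum to a field of `L²(Ω; V_Y)` -/

section Corrector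

variable {N : ℕ} {Ω : Set (Space N)} {u₁ : Space N × Space N → Space N}
  {e : Fin N → Fin N → Space N → ℝ} {χ : Fin N → Fin N → Space N → Space N}

/-- On a slice the factors `e i j x` are constants, so they pass through the derivative in `y`. -/
theorem MemL2VY.hasWeakPartialY_add_sum (hu : MemL2VY Ω u₁)
    (he : ∀ i j, AEStronglyMeasurable (e i j) (volume.restrict Ω)) (hχ : ∀ i j, MemVY (χ i j))
    (k l : Fin N) :
    HasWeakPartialY Ω l (fun p => (u₁ p + ∑ i, ∑ j, e i j p.1 • χ i j p.2) k)
      (fun p => weakPartialY Ω l (fun q => u₁ q k) p +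
        ∑ i, ∑ j, e i j p.1 * weakPartial univ l (fun y => χ i j y k) p.2) := by
  have h := hasWeakPartialY_weakPartialY (hu.2.2.1 k l)
  have hX i j := hasWeakPartial_weakPartial ((hχ i j k).2.1 l)
  refine ⟨?_, ?_⟩
  · have hm := h.1
    rw [volume_restrict_prod_univ] at hm ⊢
    refine hm.add ?_
    refine Finset.aestronglyMeasurable_fun_sum _ fun i _ =>
      Finset.aestronglyMeasurable_fun_sum _ fun j _ => ?_
    exact (he i j).comp_fst.mul
      (locallyIntegrableOn_univ.1 (hX i j).2.1).aestronglyMeasurable.comp_snd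
  · filter_upwards [h.2] with x hx
    have := hx.add (HasWeakPartial.sum Finset.univ fun i =>
      HasWeakPartial.sum Finset.univ fun j => (hX i j).const_mul (e i j x))
    simpa using this

/-- Makes the residual `g` an admissible microscopic test field. Square integrability of `e i j`
suffices because the variables separate. -/
theorem MemL2VY.add_sum (hu : MemL2VY Ω u₁)
    (he : ∀ i j, MemLp (e i j) 2 (volume.restrict Ω)) (hχ : ∀ i j, MemVY (χ i j)) :
    MemL2VY Ω fun p => u₁ p + ∑ i, ∑ j, e i j p.1 • χ i j p.2 := by
  have hD k l := hu.hasWeakPartialY_add_sum (fun i j => (he i j).1) hχ k l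
  refine ⟨?_, ?_, fun k l => ⟨_, hD k l⟩, fun k l => ?_⟩
  · have hm := hu.1
    rw [volume_restrict_prod_univ] at hm ⊢
    refine hm.add ?_
    refine Finset.aestronglyMeasurable_fun_sum _ fun i _ =>
      Finset.aestronglyMeasurable_fun_sum _ fun j _ => ?_
    exact (he i j).1.comp_fst.smul (hχ i j).aestronglyMeasurable.comp_snd
  · filter_upwards [hu.2.1] with x hx
    exact hx.add (MemVY.sum _ fun i => MemVY.sum _ fun j => (hχ i j).const_smul (e i j x))
  · have hae := (hD k l).weakPartialY_ae_eq
    refine MemLp.ae_eq (EventuallyEq.symm (ae_restrict_of_ae_restrict_of_subset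
      (Set.prod_mono_right (subset_univ _)) hae)) ?_
    refine (hu.2.2.2 k l).add ?_
    rw [volume_restrict_prod]
    exact memLp_finsetSum _ fun i _ => memLp_finsetSum _ fun j _ =>
      memLp_fst_mul_snd (he i j) ((hχ i j k).2.2.1 l).memLp_cell

theorem MemL2VY.strainY_add_sum (hu : MemL2VY Ω u₁)
    (he : ∀ i j, MemLp (e i j) 2 (volume.restrict Ω)) (hχ : ∀ i j, MemVY (χ i j)) (k l : Fin N) :
    strainY Ω (fun p => u₁ p + ∑ i, ∑ j, e i j p.1 • χ i j p.2) k l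
      =ᵐ[volume.restrict (Ω ×ˢ univ)]
      fun p => strainY Ω u₁ k l p + ∑ i, ∑ j, e i j p.1 * strain univ (χ i j) k l p.2 := by
  have hD k l := (hu.hasWeakPartialY_add_sum (fun i j => (he i j).1) hχ k l).weakPartialY_ae_eq
  filter_upwards [hD k l, hD l k] with p h1 h2
  simp only [strainY, strain, h1, h2, mul_div_assoc', mul_add, ← Finset.sum_div,
    Finset.sum_add_distrib]
  ring

end Corrector

/-! ### Integrability of strains -/

theorem MemL2VY.memLp_strainY {N : ℕ} {Ω : Set (Space N)} {v : Space N × Space N → Space N}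
    (hv : MemL2VY Ω v) (k l : Fin N) :
    MemLp (strainY Ω v k l) 2 (volume.restrict (Ω ×ˢ cell N)) := by
  have := ((hv.2.2.2 k l).add (hv.2.2.2 l k)).const_mul (2 : ℝ)⁻¹
  refine this.ae_eq (ae_of_all _ fun p => ?_)
  simp [strainY, div_eq_inv_mul]

theorem MemH1.memLp_strain {N : ℕ} {O : Set (Space N)} {v : Space N → Space N}
    (hv : MemH1 O v) (k l : Fin N) : MemLp (strain O v k l) 2 (volume.restrict O) := by
  have := ((hv.2.2 k l).add (hv.2.2 l k)).const_mul (2 : ℝ)⁻¹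
  refine this.ae_eq (ae_of_all _ fun p => ?_)
  simp [strain, div_eq_inv_mul]

theorem MemVY.memLp_strain {N : ℕ} {v : Space N → Space N}
    (hv : MemVY v) (k l : Fin N) : MemLp (strain univ v k l) 2 (volume.restrict (cell N)) := by
  have := (((hv k).2.2.1 l).memLp_cell.add ((hv l).2.2.1 k).memLp_cell).const_mul (2 : ℝ)⁻¹
  refine this.ae_eq (ae_of_all _ fun p => ?_)
  simp [strain, div_eq_inv_mul]

theorem MemL2VY.ae_strain_eq {N : ℕ} {Ω : Set (Space N)} {v : Space N × Space N → Space N}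
    (hv : MemL2VY Ω v) (k l : Fin N) :
    ∀ᵐ x ∂volume.restrict Ω,
      ∀ᵐ y, strain univ (fun z => v (x, z)) k l y = strainY Ω v k l (x, y) := by
  obtain ⟨g, hg⟩ := hv.2.2.1 k l
  obtain ⟨g', hg'⟩ := hv.2.2.1 l k
  filter_upwards [hg.ae_weakPartial_eq, hg'.ae_weakPartial_eq] with x h1 h2
  filter_upwards [h1, h2] with y h1 h2
  simp only [strain, strainY, h1, h2]

/-- Hölder's inequality with exponents `∞, 2, 2`. -/
theorem integrable_mul_mul {X : Type*} [MeasurableSpace X] {μ : Measure X} {a f g : X → ℝ}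
    {C : ℝ} (ha : AEStronglyMeasurable a μ) (hC : ∀ᵐ x ∂μ, ‖a x‖ ≤ C) (hf : MemLp f 2 μ)
    (hg : MemLp g 2 μ) : Integrable (fun x => a x * f x * g x) μ := by
  simpa only [mul_assoc, Pi.mul_apply] using (hf.integrable_mul hg).bdd_mul ha hC

/-! ### The zero field -/

theorem memH1_zero {N : ℕ} {O : Set (Space N)} (hO : IsOpen O) :
    MemH1 O fun _ => (0 : Space N) := by
  refine ⟨fun i => MemLp.zero, fun i j => ⟨_, hasWeakPartial_zero O j⟩, fun i j => ?_⟩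
  exact MemLp.zero.ae_eq ((hasWeakPartial_zero O j).weakPartial_ae_eq hO).symm

theorem strain_zero {N : ℕ} {O : Set (Space N)} (hO : IsOpen O) (i j : Fin N) :
    strain O (fun _ => (0 : Space N)) i j =ᵐ[volume.restrict O] 0 := by
  filter_upwards [(hasWeakPartial_zero O j).weakPartial_ae_eq hO,
    (hasWeakPartial_zero O i).weakPartial_ae_eq hO] with x h1 h2
  simp only [strain, PiLp.zero_apply, h1, h2, Pi.zero_apply]
  norm_num

theorem isTestField_zero {N : ℕ} : IsTestField fun _ : Space N => (0 : Space N) :=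
  ⟨contDiff_const, HasCompactSupport.zero⟩

theorem h1Dist_self {N : ℕ} (O : Set (Space N)) (u : Space N → Space N) : h1Dist O u u = 0 := by
  simp [h1Dist]

theorem memV_zero {N : ℕ} {Ω : Set (Space N)} (hΩ : IsOpen Ω) (Γ : Set (Space N)) :
    MemV Ω Γ fun _ => (0 : Space N) :=
  ⟨memH1_zero hΩ, fun _ _ => 0, fun _ => ⟨isTestField_zero, fun _ _ => rfl⟩, by
    simp [h1Dist_self]⟩

theorem isTrace_zero {N : ℕ} {Ω : Set (Space N)} (hΩ : IsOpen Ω) :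
    IsTrace Ω (fun _ => (0 : Space N)) fun _ => 0 :=
  ⟨memH1_zero hΩ, MemLp.zero, fun _ _ => 0, fun _ => isTestField_zero, by
    simp [h1Dist_self], by simp⟩

/-! ### The variational problems tested with a corrector -/

theorem integrable_fourfold_sum {X : Type*} [MeasurableSpace X] {μ : Measure X} {N : ℕ}
    {F : Fin N → Fin N → Fin N → Fin N → X → ℝ} (hF : ∀ i j k h, Integrable (F i j k h) μ) :
    Integrable (fun x => ∑ i, ∑ j, ∑ k, ∑ h, F i j k h x) μ :=
  integrable_finsetSum _ fun i _ => integrable_finsetSum _ fun j _ =>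
    integrable_finsetSum _ fun k _ => integrable_finsetSum _ fun h _ => hF i j k h

theorem integral_fourfold_sum {X : Type*} [MeasurableSpace X] {μ : Measure X} {N : ℕ}
    {F : Fin N → Fin N → Fin N → Fin N → X → ℝ} (hF : ∀ i j k h, Integrable (F i j k h) μ) :
    ∫ x, ∑ i, ∑ j, ∑ k, ∑ h, F i j k h x ∂μ = ∑ i, ∑ j, ∑ k, ∑ h, ∫ x, F i j k h x ∂μ := by
  have h1 i j k := integrable_finsetSum Finset.univ fun h (_ : h ∈ Finset.univ) => hF i j k h
  have h2 i j := integrable_finsetSum Finset.univ fun k (_ : k ∈ Finset.univ) => h1 i j k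
  have h3 i := integrable_finsetSum Finset.univ fun j (_ : j ∈ Finset.univ) => h2 i j
  rw [integral_finsetSum _ fun i _ => h3 i]
  refine Finset.sum_congr rfl fun i _ => ?_
  rw [integral_finsetSum _ fun j _ => h2 i j]
  refine Finset.sum_congr rfl fun j _ => ?_
  rw [integral_finsetSum _ fun k _ => h1 i j k]
  refine Finset.sum_congr rfl fun k _ => ?_
  rw [integral_finsetSum _ fun h _ => hF i j k h]

theorem integral_twofold_sum {X : Type*} [MeasurableSpace X] {μ : Measure X} {N : ℕ}
    {F : Fin N → Fin N → X → ℝ} (hF : ∀ i j, Integrable (F i j) μ) :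
    ∫ x, ∑ i, ∑ j, F i j x ∂μ = ∑ i, ∑ j, ∫ x, F i j x ∂μ := by
  have h1 i := integrable_finsetSum Finset.univ fun j (_ : j ∈ Finset.univ) => hF i j
  rw [integral_finsetSum _ fun i _ => h1 i]
  refine Finset.sum_congr rfl fun i _ => ?_
  rw [integral_finsetSum _ fun j _ => hF i j]

theorem sum_comm_four_two {N : ℕ} (F : Fin N → Fin N → Fin N → Fin N → Fin N → Fin N → ℝ) :
    ∑ p, ∑ q, ∑ k, ∑ h, ∑ i, ∑ j, F p q k h i j = ∑ i, ∑ j, ∑ p, ∑ q, ∑ k, ∑ h, F p q k h i j := by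
  -- Bundling the indices into a quadruple and a pair reduces the exchange to a single swap.
  have := Finset.sum_comm (s := Finset.univ) (t := Finset.univ)
    (f := fun (x : Fin N × Fin N × Fin N × Fin N) (y : Fin N × Fin N) =>
      F x.1 x.2.1 x.2.2.1 x.2.2.2 y.1 y.2)
  simpa only [Fintype.sum_prod_type] using this

section

variable {N : ℕ} {Ω T : Set (Space N)} {a : Fin N → Fin N → Fin N → Fin N → Space N → ℝ}

theorem volume_restrict_perforated_le (Ω T : Set (Space N)) :
    (volume : Measure (Space N × Space N)).restrict (Ω ×ˢ perforatedCell T) ≤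
      volume.restrict (Ω ×ˢ cell N) :=
  Measure.restrict_mono_set _ (Set.prod_mono_right sdiff_subset)

theorem integrable_coefficient_mul_mul (ha : ∀ i j k h, MemLp (a i j k h) ⊤ volume)
    {F G : Space N × Space N → ℝ}
    (hF : MemLp F 2 (volume.restrict (Ω ×ˢ perforatedCell T)))
    (hG : MemLp G 2 (volume.restrict (Ω ×ˢ perforatedCell T))) (i j k h : Fin N) :
    Integrable (fun p => a i j k h p.2 * F p * G p) (volume.restrict (Ω ×ˢ perforatedCell T)) := by
  have hC : ∀ᵐ y, ‖a i j k h y‖ ≤ (eLpNorm (a i j k h) ⊤ volume).toReal := by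
    filter_upwards [ae_le_eLpNormEssSup (f := a i j k h) (μ := volume)] with y hy
    rw [← toReal_enorm]
    exact ENNReal.toReal_mono (ha i j k h).2.ne (by rwa [eLpNorm_exponent_top])
  rw [volume_restrict_prod] at hF hG ⊢
  exact integrable_mul_mul (ha i j k h).1.restrict.comp_snd (ae_snd_prod_restrict _ _ hC) hF hG

/-- The test pair is `(0, v)` with zero trace: every term containing `v₀` drops out. -/
theorem IsGlobalSolution.form_strainY_eq_zero (hΩ : IsOpen Ω) {Γ₁ Γ₂ : Set (Space N)} {θ : Space N → ℝ}
    {f t u₀ : Space N → Space N} {u₁ v : Space N × Space N → Space N}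
    (hu : IsGlobalSolution Ω T Γ₁ Γ₂ a θ f t u₀ u₁) (hv : MemL2VY Ω v) :
    ∑ i, ∑ j, ∑ k, ∑ h, ∫ p in Ω ×ˢ perforatedCell T,
      a i j k h p.2 * (strain Ω u₀ i j p.1 + strainY Ω u₁ i j p) * strainY Ω v k h p = 0 := by
  have key := hu.2.2 _ _ v (memV_zero hΩ Γ₁) (isTrace_zero hΩ) hv
  simp only [globalForm, globalLoad, inner_zero_right, mul_zero, integral_zero, add_zero] at key
  rw [← key]
  refine Finset.sum_congr rfl fun i _ => Finset.sum_congr rfl fun j _ =>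
    Finset.sum_congr rfl fun k _ => Finset.sum_congr rfl fun h _ => integral_congr_ae ?_
  have h0 : ∀ᵐ p ∂(volume : Measure (Space N × Space N)).restrict (Ω ×ˢ perforatedCell T),
      strain Ω (fun _ => (0 : Space N)) k h p.1 = 0 := by
    rw [volume_restrict_prod]
    exact Measure.quasiMeasurePreserving_fst.ae (strain_zero hΩ k h)
  filter_upwards [h0] with p hp
  simp only [twoScaleStrain, hp, zero_add]

/-- The cell identity, tested with `v(x, ·)`, is weighted by `e x` and integrated over `Ω` by
Fubini. -/
theorem IsCellSolution.integral_mul_strainY (ha : ∀ i j k h, MemLp (a i j k h) ⊤ volume)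
    {i j : Fin N} {χ : Space N → Space N} (hχ : IsCellSolution T a i j χ)
    {e : Space N → ℝ} (he : MemLp e 2 (volume.restrict Ω))
    {v : Space N × Space N → Space N} (hv : MemL2VY Ω v) :
    ∑ p, ∑ q, ∑ k, ∑ h, ∫ z in Ω ×ˢ perforatedCell T,
        a p q k h z.2 * (e z.1 * strain univ χ p q z.2) * strainY Ω v k h z =
      ∑ k, ∑ h, ∫ z in Ω ×ˢ perforatedCell T, a i j k h z.2 * e z.1 * strainY Ω v k h z := by
  -- Needed for `e`, constant in `y`, to be square integrable on `Ω × Y*`.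
  have hfin : IsFiniteMeasure (volume.restrict (perforatedCell T)) :=
    isFiniteMeasure_restrict.2 ((isBounded_cell N).subset sdiff_subset).measure_lt_top.ne
  have hS k h := (hv.memLp_strainY k h).mono_measure (volume_restrict_perforated_le Ω T)
  have hX p q := (hχ.1.memLp_strain p q).mono_measure
    (Measure.restrict_mono_set volume (sdiff_subset (s := cell N) (t := T)))
  have heX p q : MemLp (fun z : Space N × Space N => e z.1 * strain univ χ p q z.2) 2
      (volume.restrict (Ω ×ˢ perforatedCell T)) := by
    rw [volume_restrict_prod]
    exact memLp_fst_mul_snd he (hX p q)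
  have he' : MemLp (fun z : Space N × Space N => e z.1) 2
      (volume.restrict (Ω ×ˢ perforatedCell T)) := by
    rw [volume_restrict_prod]
    exact he.comp_fst _
  have hl p q k h := integrable_coefficient_mul_mul ha (heX p q) (hS k h) p q k h
  have hr k h := integrable_coefficient_mul_mul ha he' (hS k h) i j k h
  rw [volume_restrict_prod] at hl hr ⊢
  simp_rw [integral_prod _ (hl _ _ _ _), integral_prod _ (hr _ _)]
  rw [← integral_fourfold_sum fun p q k h => (hl p q k h).integral_prod_left,
    ← integral_twofold_sum fun k h => (hr k h).integral_prod_left]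
  refine integral_congr_ae ?_
  have hae : ∀ᵐ x ∂volume.restrict Ω, ∀ k h, ∀ᵐ y ∂volume.restrict (perforatedCell T),
      strain univ (fun z => v (x, z)) k h y = strainY Ω v k h (x, y) := by
    simp only [ae_all_iff]
    intro k h
    filter_upwards [hv.ae_strain_eq k h] with x hx using ae_restrict_of_ae hx
  filter_upwards [hv.2.1, hae] with x hx hs
  have key := congrArg (e x * ·) (hχ.2 _ hx)
  simp only [cellForm, Finset.mul_sum, ← integral_const_mul] at key
  calc _ = _ := ?_
    _ = _ := key
    _ = _ := ?_
  · refine Finset.sum_congr rfl fun p _ => Finset.sum_congr rfl fun q _ =>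
      Finset.sum_congr rfl fun k _ => Finset.sum_congr rfl fun h _ => integral_congr_ae ?_
    filter_upwards [hs k h] with y hy
    rw [hy]
    ring
  · refine Finset.sum_congr rfl fun k _ => Finset.sum_congr rfl fun h _ => integral_congr_ae ?_
    filter_upwards [hs k h] with y hy
    rw [hy]
    ring

/-- The quadratic integrand is nonnegative with zero integral, hence zero a.e.; it dominates `α`
times the sum of squared strains. -/
theorem strainY_ae_eq_zero_of_form_eq_zero (ha : ∀ i j k h, MemLp (a i j k h) ⊤ volume)
    {α : ℝ} (hα : 0 < α)
    (ha_ell : ∀ᵐ y, ∀ ζ : Fin N → Fin N → ℝ,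
      α * ∑ i, ∑ j, ζ i j ^ 2 ≤ ∑ i, ∑ j, ∑ k, ∑ h, a i j k h y * ζ i j * ζ k h)
    {v : Space N × Space N → Space N} (hv : MemL2VY Ω v)
    (h0 : ∑ i, ∑ j, ∑ k, ∑ h, ∫ p in Ω ×ˢ perforatedCell T,
      a i j k h p.2 * strainY Ω v i j p * strainY Ω v k h p = 0) (i j : Fin N) :
    ∀ᵐ p ∂volume.restrict (Ω ×ˢ perforatedCell T), strainY Ω v i j p = 0 := by
  have hS k h := (hv.memLp_strainY k h).mono_measure (volume_restrict_perforated_le Ω T)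
  have hint i j k h := integrable_coefficient_mul_mul ha (hS i j) (hS k h) i j k h
  -- The exceptional null set is independent of `ζ`, so `ζ` may be the strain at `p` itself.
  have hell : ∀ᵐ p ∂(volume : Measure (Space N × Space N)).restrict (Ω ×ˢ perforatedCell T),
      ∀ ζ : Fin N → Fin N → ℝ,
      α * ∑ i, ∑ j, ζ i j ^ 2 ≤ ∑ i, ∑ j, ∑ k, ∑ h, a i j k h p.2 * ζ i j * ζ k h := by
    rw [volume_restrict_prod]
    exact ae_snd_prod_restrict _ _ ha_ell
  have hsq (ζ : Fin N → Fin N → ℝ) : 0 ≤ ∑ i, ∑ j, ζ i j ^ 2 :=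
    Finset.sum_nonneg fun _ _ => Finset.sum_nonneg fun _ _ => sq_nonneg _
  rw [← integral_fourfold_sum hint, integral_eq_zero_iff_of_nonneg_ae
    (hell.mono fun p hp => (mul_nonneg hα.le (hsq _)).trans (hp fun i j => strainY Ω v i j p))
    (integrable_fourfold_sum hint)] at h0
  filter_upwards [h0, hell] with p hp0 hp
  have h1 := (hp fun i j => strainY Ω v i j p).trans_eq hp0
  have h2 := hsq fun i j => strainY Ω v i j p
  have h3 : ∑ i, ∑ j, strainY Ω v i j p ^ 2 = 0 :=
    le_antisymm (nonpos_of_mul_nonpos_right h1 hα) h2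
  rw [Finset.sum_eq_zero_iff_of_nonneg fun _ _ => Finset.sum_nonneg fun _ _ => sq_nonneg _] at h3
  have h4 := h3 i (Finset.mem_univ _)
  rw [Finset.sum_eq_zero_iff_of_nonneg fun _ _ => sq_nonneg _] at h4
  exact pow_eq_zero_iff two_ne_zero |>.1 (h4 j (Finset.mem_univ _))

/-- Orthogonality of the residual to every microscopic test field: the cell problems turn its
corrector part into the `e(u₀)` part of the global equation. -/
theorem form_add_sum_eq_zero (hΩ : IsOpen Ω) (ha : ∀ i j k h, MemLp (a i j k h) ⊤ volume)
    {Γ₁ Γ₂ : Set (Space N)} {θ : Space N → ℝ}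
    {f t u₀ : Space N → Space N} {u₁ v : Space N × Space N → Space N}
    (hu : IsGlobalSolution Ω T Γ₁ Γ₂ a θ f t u₀ u₁)
    {χ : Fin N → Fin N → Space N → Space N} (hχ : ∀ i j, IsCellSolution T a i j (χ i j))
    (hv : MemL2VY Ω v) :
    ∑ p, ∑ q, ∑ k, ∑ h, ∫ z in Ω ×ˢ perforatedCell T, a p q k h z.2 *
      strainY Ω (fun p => u₁ p + ∑ i, ∑ j, strain Ω u₀ i j p.1 • χ i j p.2) p q z *
        strainY Ω v k h z = 0 := by
  have hfin : IsFiniteMeasure (volume.restrict (perforatedCell T)) :=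
    isFiniteMeasure_restrict.2 ((isBounded_cell N).subset sdiff_subset).measure_lt_top.ne
  have he i j := hu.1.1.memLp_strain i j
  have hS k h := (hv.memLp_strainY k h).mono_measure (volume_restrict_perforated_le Ω T)
  have hG k h := (hu.2.1.memLp_strainY k h).mono_measure (volume_restrict_perforated_le Ω T)
  have he' i j : MemLp (fun z : Space N × Space N => strain Ω u₀ i j z.1) 2
      (volume.restrict (Ω ×ˢ perforatedCell T)) := by
    rw [volume_restrict_prod]
    exact (he i j).comp_fst _
  have heX i j p q : MemLp
      (fun z : Space N × Space N => strain Ω u₀ i j z.1 * strain univ (χ i j) p q z.2) 2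
      (volume.restrict (Ω ×ˢ perforatedCell T)) := by
    rw [volume_restrict_prod]
    exact memLp_fst_mul_snd (he i j) (((hχ i j).1.memLp_strain p q).mono_measure
      (Measure.restrict_mono_set volume sdiff_subset))
  have split p q k h : ∫ z in Ω ×ˢ perforatedCell T, a p q k h z.2 *
      strainY Ω (fun p => u₁ p + ∑ i, ∑ j, strain Ω u₀ i j p.1 • χ i j p.2) p q z *
        strainY Ω v k h z =
      (∫ z in Ω ×ˢ perforatedCell T, a p q k h z.2 * strainY Ω u₁ p q z * strainY Ω v k h z) +
      ∑ i, ∑ j, ∫ z in Ω ×ˢ perforatedCell T, a p q k h z.2 *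
        (strain Ω u₀ i j z.1 * strain univ (χ i j) p q z.2) * strainY Ω v k h z := by
    have hint i j := integrable_coefficient_mul_mul ha (heX i j p q) (hS k h) p q k h
    rw [← integral_twofold_sum hint, ← integral_add
      (integrable_coefficient_mul_mul ha (hG p q) (hS k h) p q k h)
      (integrable_finsetSum _ fun i _ => integrable_finsetSum _ fun j _ => hint i j)]
    refine integral_congr_ae ?_
    filter_upwards [ae_restrict_of_ae_restrict_of_subset (Set.prod_mono_right (subset_univ _))
      (hu.2.1.strainY_add_sum he (fun i j => (hχ i j).1) p q)] with z hz
    simp only [hz, mul_add, add_mul, Finset.mul_sum, Finset.sum_mul]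
  have hglob := IsGlobalSolution.form_strainY_eq_zero hΩ hu hv
  have hsplit p q k h : ∫ z in Ω ×ˢ perforatedCell T,
      a p q k h z.2 * (strain Ω u₀ p q z.1 + strainY Ω u₁ p q z) * strainY Ω v k h z =
      (∫ z in Ω ×ˢ perforatedCell T, a p q k h z.2 * strain Ω u₀ p q z.1 * strainY Ω v k h z) +
      ∫ z in Ω ×ˢ perforatedCell T, a p q k h z.2 * strainY Ω u₁ p q z * strainY Ω v k h z := by
    rw [← integral_add (integrable_coefficient_mul_mul ha (he' p q) (hS k h) p q k h)
      (integrable_coefficient_mul_mul ha (hG p q) (hS k h) p q k h)]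
    simp only [mul_add, add_mul]
  simp only [hsplit, Finset.sum_add_distrib] at hglob
  simp only [split, Finset.sum_add_distrib]
  -- With `i, j` outermost, each inner sum is the left side of the weighted cell identity for `χ i
  -- j`.
  rw [sum_comm_four_two]
  simp only [fun i j => (hχ i j).integral_mul_strainY ha (he i j) hv]
  rw [← hglob, add_comm]

end

end PerforatedElasticity

open PerforatedElasticity in
theorem lemma3p3 {N : ℕ} (hN : 2 ≤ N)
    -- the domain, the inclusion and the two parts of the outer boundary
    (Ω T Γ₁ Γ₂ : Set (Space N))
    (hΩ_open : IsOpen Ω) (hΩ_bdd : Bornology.IsBounded Ω) (hΩ_smooth : HasSmoothBoundary Ω)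
    (hT_compact : IsCompact T) (hT_smooth : HasSmoothBoundary T)
    (hT_int : (interior T).Nonempty) (hT_cell : T ⊆ cell N)
    (hΓ₁_open : IsOpenPart Γ₁ (frontier Ω)) (hΓ₂_open : IsOpenPart Γ₂ (frontier Ω))
    (hΓ_disj : Disjoint Γ₁ Γ₂) (hΓ_cover : frontier Ω = closure Γ₁ ∪ closure Γ₂)
    (hΓ₁_pos : 0 < surfaceMeasure (frontier Ω) Γ₁)
    -- the elasticity coefficients
    (a : Fin N → Fin N → Fin N → Fin N → Space N → ℝ)
    (ha_bdd : ∀ i j k h, MemLp (a i j k h) ⊤ volume)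
    (ha_symm : ∀ i j k h, ∀ᵐ y, a i j k h y = a j i h k y ∧ a i j k h y = a k h i j y)
    (α : ℝ) (hα : 0 < α)
    (ha_ell : ∀ᵐ y, ∀ ζ : Fin N → Fin N → ℝ,
      α * ∑ i, ∑ j, ζ i j ^ 2 ≤ ∑ i, ∑ j, ∑ k, ∑ h, a i j k h y * ζ i j * ζ k h)
    (ha_per : ∀ i j k h, IsPeriodicAE volume (a i j k h))
    -- the Robin coefficient on the boundaries of the inclusions
    (θ : Space N → ℝ) (α₀ : ℝ) (hα₀ : 0 < α₀)
    (hθ_bdd : MemLp θ ⊤ (surfaceMeasure (frontier (periodicInclusions T))))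
    (hθ_ge : ∀ᵐ y ∂surfaceMeasure (frontier (periodicInclusions T)), α₀ ≤ θ y)
    (hθ_per : IsPeriodicAE (surfaceMeasure (frontier (periodicInclusions T))) θ)
    -- the volume forces and the surface traction
    (f t : Space N → Space N)
    (hf_bdd : MemLp f ⊤ volume) (hf_per : IsPeriodicAE volume f)
    (ht : MemLp t 2 (surfaceMeasure (frontier Ω)))
    -- the solution of the global homogenized problem and the solutions of the cell problems
    (u₀ : Space N → Space N) (u₁ : Space N × Space N → Space N)
    (hu : IsGlobalSolution Ω T Γ₁ Γ₂ a θ f t u₀ u₁)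
    (χ : Fin N → Fin N → Space N → Space N)
    (hχ : ∀ i j, IsCellSolution T a i j (χ i j)) :
    ∃ g : Space N × Space N → Space N,
      MemL2VY Ω g ∧
      (∀ i j, ∀ᵐ p ∂volume.restrict (Ω ×ˢ perforatedCell T), strainY Ω g i j p = 0) ∧
      ∀ᵐ p ∂volume.restrict (Ω ×ˢ univ),
        u₁ p = -(∑ i, ∑ j, strain Ω u₀ i j p.1 • χ i j p.2) + g p := by
  have hg := hu.2.1.add_sum (fun i j => hu.1.1.memLp_strain i j) fun i j => (hχ i j).1
  refine ⟨_, hg, fun i j => ?_, ?_⟩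
  -- The residual is tested against itself.
  · exact strainY_ae_eq_zero_of_form_eq_zero ha_bdd hα ha_ell hg
      (form_add_sum_eq_zero hΩ_open ha_bdd hu hχ hg) i j
  · exact ae_of_all _ fun p => by abel
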